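/- Let $\mathcal A$ be an artinian abelian category, i.e. an abelian category in which every descending chain of subobjects of any object is stationary, and let $S$ be a set of prime numbers. Let $\mathcal A_S$ be the full subcategory of $\mathcal A$ whose objects are the $S$-primary torsion objects, that is, those $X$ such that $n\cdot \mathrm{id}_X=0$ for some positive integer $n$ all of whose prime factors belong to $S$; this is a Serre subcategory of $\mathcal A$. Let $\mathcal A/\mathcal A_S$ be the quotient abelian category, i.e. the localization of $\mathcal A$ at the morphisms whose kernel and cokernel belong to $\mathcal A_S$. For an abelian category $\mathcal C$, let $\mathrm{hd}(\mathcal C)\in\{0,1,2,\dots\}\cup\{\infty\}$ denote its homological dimension: the smallest integer $n\ge 0$ such that $\mathrm{Ext}^i_{\mathcal C}(X,Y)=0$ for all objects $X,Y$ of $\mathcal C$ and all $i>n$, or $\infty$ if there is no such $n$. Then $$\mathrm{hd}(\mathcal A)=\max\bigl(\mathrm{hd}(\mathcal A_S),\,\mathrm{hd}(\mathcal A/\mathcal A_S)\bigr).$$ -/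

import Mathlib

universe v u

namespace TorsionHd

open CategoryTheory CategoryTheory.Limits

/-- The homological dimension of an abelian category, as an element of `ℕ ∪ {∞}`: the smallest
natural number `n` such that `Ext^i(X, Y) = 0` for all objects `X`, `Y` and all `i > n`, and
`∞` if no such `n` exists. -/
noncomputable def hd (C : Type u) [Category.{v} C] [Abelian C] : ℕ∞ :=
  letI := HasExt.standard C
  ⨅ (n : ℕ) (_ : ∀ (X Y : C) (i : ℕ), n < i → Subsingleton (Abelian.Ext.{max u v} X Y i)),
    (n : ℕ∞)

/-- The set `⟨S⟩` of positive integers all of whose prime factors belong to `S`. -/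
def primeSpan (S : Set Nat.Primes) : Set ℕ :=
  {n | 0 < n ∧ ∀ p : Nat.Primes, (p : ℕ) ∣ n → p ∈ S}

/-- The property of being an `S`-torsion object: multiplication by some `n ∈ ⟨S⟩` is zero. -/
def torsion (A : Type u) [Category.{v} A] [Abelian A] (S : Set Nat.Primes) : ObjectProperty A :=
  fun X => ∃ n ∈ primeSpan S, n • 𝟙 X = 0

theorem one_mem_primeSpan (S : Set Nat.Primes) : 1 ∈ primeSpan S :=
  ⟨one_pos, fun p hp => absurd (Nat.dvd_one.1 hp) p.2.ne_one⟩

theorem mul_mem_primeSpan {S : Set Nat.Primes} {m n : ℕ} (hm : m ∈ primeSpan S)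
    (hn : n ∈ primeSpan S) : m * n ∈ primeSpan S :=
  ⟨Nat.mul_pos hm.1 hn.1, fun p hp => ((p.2.dvd_mul).1 hp).elim (hm.2 p) (hn.2 p)⟩

/-- The `S`-torsion objects form a Serre subcategory. -/
instance torsion_isSerreClass (A : Type u) [Category.{v} A] [Abelian A] (S : Set Nat.Primes) :
    (torsion A S).IsSerreClass where
  exists_zero :=
    ⟨_, isZero_zero A, 1, one_mem_primeSpan S, (isZero_zero A).eq_of_src _ _⟩
  prop_of_mono := by
    rintro X Y f _ ⟨n, hn, h⟩
    refine ⟨n, hn, ?_⟩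
    rw [← cancel_mono f]
    have : f ≫ (n • 𝟙 Y) = 0 := by rw [h, comp_zero]
    simpa [Preadditive.nsmul_comp, Preadditive.comp_nsmul] using this
  prop_of_epi := by
    rintro X Y f _ ⟨n, hn, h⟩
    refine ⟨n, hn, ?_⟩
    rw [← cancel_epi f]
    have : (n • 𝟙 X) ≫ f = 0 := by rw [h, zero_comp]
    simpa [Preadditive.nsmul_comp, Preadditive.comp_nsmul] using this
  prop_X₂_of_shortExact := by
    rintro T hT ⟨m, hm, h₁⟩ ⟨n, hn, h₃⟩
    refine ⟨m * n, mul_mem_primeSpan hm hn, ?_⟩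
    have := hT.mono_f
    have hg : (n • 𝟙 T.X₂) ≫ T.g = 0 := by
      have : T.g ≫ (n • 𝟙 T.X₃) = 0 := by rw [h₃, comp_zero]
      simpa [Preadditive.nsmul_comp, Preadditive.comp_nsmul] using this
    have hl : hT.exact.lift _ hg ≫ T.f = n • 𝟙 T.X₂ := hT.exact.lift_f _ hg
    have hf : m • T.f = 0 := by
      have : (m • 𝟙 T.X₁) ≫ T.f = 0 := by rw [h₁, zero_comp]
      simpa [Preadditive.nsmul_comp] using this
    rw [mul_smul, ← hl, ← Preadditive.comp_nsmul, hf, comp_zero]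

instance torsion_isClosedUnderFiniteProducts (A : Type u) [Category.{v} A] [Abelian A]
    (S : Set Nat.Primes) : (torsion A S).IsClosedUnderFiniteProducts := by
  have : (torsion A S).IsClosedUnderBinaryProducts := by
    refine ⟨fun X ⟨h⟩ => ?_⟩
    have e : X ≅ h.diag.obj ⟨.left⟩ ⊞ h.diag.obj ⟨.right⟩ :=
      h.isLimit.conePointUniqueUpToIso (limit.isLimit h.diag) ≪≫
        HasLimit.isoOfNatIso (diagramIsoPair h.diag) ≪≫ (biprod.isoProd _ _).symm
    exact (torsion A S).prop_of_iso e.symm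
      ((torsion A S).prop_biprod (h.prop_diag_obj _) (h.prop_diag_obj _))
  exact .mk'

/-- The `S`-primary torsion subcategory `A_S`, a full subcategory of `A`. -/
abbrev TorsionSubcategory (A : Type u) [Category.{v} A] [Abelian A] (S : Set Nat.Primes) :
    Type u :=
  (torsion A S).FullSubcategory

/-- The quotient category `A / A_S`: the localization of `A` at the morphisms whose kernel and
cokernel are `S`-torsion. -/
abbrev TorsionQuotient (A : Type u) [Category.{v} A] [Abelian A] (S : Set Nat.Primes) :
    Type u :=
  (torsion A S).isoModSerre.Localization

/-- `A / A_S` is abelian, with the preadditive structure for which the quotient functor is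
additive. -/
noncomputable instance (A : Type u) [Category.{v} A] [Abelian A] (S : Set Nat.Primes) :
    Abelian (TorsionQuotient A S) :=
  ObjectProperty.SerreClassLocalization.abelian (torsion A S).isoModSerre.Q (torsion A S)

end TorsionHd

/-!
Both functors of the exact sequence `A_S → A → A / A_S` are exact, and epimorphisms onto objects in
their images can be refined by images of epimorphisms. Since every `Ext`-class of positive degree is
killed by pulling back along some epimorphism, dimension shifting then propagates an isomorphism on
`Hom`, possibly only up to torsion, to all `Ext`-groups. For `A_S → A` this gives the same
`Ext`-groups; the artinian hypothesis enters here, because it makes every object an extension of a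
torsion object by a divisible one. For `A → A / A_S` it gives the same `Ext`-groups up to
`S`-torsion.

If `Ext^i` vanishes on `A_S` and on `A / A_S`, it thus vanishes in `A` between torsion objects and
is `S`-torsion everywhere. Dévissage reduces its vanishing on `A` to divisible and torsion objects,
where the exact sequence of multiplication by `m` on a divisible object `D` replaces `D` by the
torsion object `D[m]`.
-/

universe w w' w'' v₁ v₂ u₁ u₂

namespace TorsionHd

open CategoryTheory CategoryTheory.Limits CategoryTheory.Abelian

section EffaceabilityOfExt

variable {C : Type u₁} [Category.{v₁} C] [Abelian C]

lemma epi_f_of_quasiIsoAt {ι : Type*} {c : ComplexShape ι} {K L : HomologicalComplex C c}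
    (s : K ⟶ L) (i : ι) [QuasiIsoAt s i] (h_prev : L.d (c.prev i) i = 0)
    (h_next : L.d i (c.next i) = 0) : Epi (s.f i) := by
  have := L.isIso_homologyπ (c.prev i) i rfl h_prev
  have := L.isIso_iCycles i (c.next i) rfl h_next
  have : Epi (HomologicalComplex.cyclesMap s i ≫ L.homologyπ i) := by
    rw [← HomologicalComplex.homologyπ_naturality]
    infer_instance
  have : Epi (HomologicalComplex.cyclesMap s i) :=
    (MorphismProperty.cancel_right_of_respectsIso (.epimorphisms C) _ (L.homologyπ i)).1 this
  have : Epi (K.iCycles i ≫ s.f i) := by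
    rw [← HomologicalComplex.cyclesMap_i]
    infer_instance
  exact epi_of_epi (K.iCycles i) _

lemma exists_epi_single_map_eq_comp {K : CochainComplex C ℤ} [K.IsStrictlyLE 0] {X : C}
    (s : K ⟶ (HomologicalComplex.single C (.up ℤ) 0).obj X) (hs : QuasiIso s) :
    ∃ (p : K.X 0 ⟶ X) (t : (HomologicalComplex.single C (.up ℤ) 0).obj (K.X 0) ⟶ K),
      Epi p ∧ (HomologicalComplex.single C (.up ℤ) 0).map p = t ≫ s := by
  have hK (j : ℤ) (hj : (ComplexShape.up ℤ).Rel 0 j) : 𝟙 (K.X 0) ≫ K.d 0 j = 0 :=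
    (K.isZero_of_isStrictlyLE 0 j (by rw [ComplexShape.up_Rel] at hj; lia)).eq_of_tgt _ _
  have : Epi (s.f 0) := epi_f_of_quasiIsoAt s 0
    (HomologicalComplex.single_obj_d ..) (HomologicalComplex.single_obj_d ..)
  refine ⟨s.f 0 ≫ (HomologicalComplex.singleObjXSelf (.up ℤ) 0 X).hom,
    HomologicalComplex.mkHomFromSingle (𝟙 (K.X 0)) hK, epi_comp _ _, ?_⟩
  apply HomologicalComplex.from_single_hom_ext
  simp [HomologicalComplex.single_map_f_self]

open DerivedCategory in
lemma exists_epi_Q_map_single_map_comp_eq_zero [HasDerivedCategory.{w} C] {X : C}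
    {L : CochainComplex C ℤ} (hL : IsZero (L.X 0))
    (f : Q.obj ((CochainComplex.singleFunctor C 0).obj X) ⟶ Q.obj L) :
    ∃ (Z : C) (p : Z ⟶ X), Epi p ∧ Q.map ((CochainComplex.singleFunctor C 0).map p) ≫ f = 0 := by
  have : ((CochainComplex.singleFunctor C 0).obj X).IsStrictlyLE 0 := inferInstanceAs
    (CochainComplex.IsStrictlyLE ((HomologicalComplex.single C (.up ℤ) 0).obj X) 0)
  obtain ⟨K, _, s, hs, g, rfl⟩ := right_fac_of_isStrictlyLE f 0
  obtain ⟨p, t, hp, hpt⟩ :=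
    exists_epi_single_map_eq_comp s ((isIso_Q_map_iff_quasiIso C s).1 hs)
  let t' : (CochainComplex.singleFunctor C 0).obj (K.X 0) ⟶ K := t
  have hpt' : (CochainComplex.singleFunctor C 0).map p = t' ≫ s := hpt
  have htg : t' ≫ g = 0 := HomologicalComplex.from_single_hom_ext (hL.eq_of_tgt _ _)
  refine ⟨K.X 0, p, hp, ?_⟩
  rw [hpt', Functor.map_comp, Category.assoc, IsIso.hom_inv_id_assoc, ← Functor.map_comp, htg,
    Functor.map_zero]

open DerivedCategory in
attribute [local instance] HasDerivedCategory.standard in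
theorem exists_epi_mk₀_comp_eq_zero [HasExt.{w} C] {X Y : C} {n : ℕ} (e : Ext.{w} X Y (n + 1)) :
    ∃ (Z : C) (p : Z ⟶ X), Epi p ∧ (Ext.mk₀ p).comp e (zero_add _) = 0 := by
  let KX := (CochainComplex.singleFunctor C 0).obj X
  let KY := (CochainComplex.singleFunctor C 0).obj Y
  let shiftIso := (Q.commShiftIso ((n + 1 : ℕ) : ℤ)).app KY
  let e' : Q.obj KX ⟶ (Q.obj KY)⟦((n + 1 : ℕ) : ℤ)⟧ := e.hom
  have hKY : IsZero ((KY⟦((n + 1 : ℕ) : ℤ)⟧).X 0) := by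
    apply HomologicalComplex.isZero_single_obj_X (.up ℤ) 0 Y (0 + ((n + 1 : ℕ) : ℤ))
    lia
  obtain ⟨Z, p, hp, h⟩ := exists_epi_Q_map_single_map_comp_eq_zero hKY (e' ≫ shiftIso.inv)
  refine ⟨Z, p, hp, Ext.ext ?_⟩
  rw [Ext.comp_hom, Ext.mk₀_hom, Ext.zero_hom, ShiftedHom.mk₀_comp]
  rwa [← Category.assoc, Preadditive.IsIso.comp_right_eq_zero] at h

end EffaceabilityOfExt

section ExtNSMul

variable {C : Type u₁} [Category.{v₁} C] [Abelian C] [HasExt.{w} C]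

lemma ext_comp_nsmul {X Y Z : C} {a b c : ℕ} (m : ℕ) (α : Ext.{w} X Y a) (β : Ext.{w} Y Z b)
    (h : a + b = c) : α.comp (m • β) h = m • α.comp β h :=
  map_nsmul (Ext.bilinearComp X Y Z a b c h α) m β

lemma ext_nsmul_comp {X Y Z : C} {a b c : ℕ} (m : ℕ) (α : Ext.{w} X Y a) (β : Ext.{w} Y Z b)
    (h : a + b = c) : (m • α).comp β h = m • α.comp β h :=
  map_nsmul ((Ext.bilinearComp X Y Z a b c h).flip β) m α

lemma ext_comp_sub {X Y Z : C} {a b c : ℕ} (α : Ext.{w} X Y a) (β β' : Ext.{w} Y Z b)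
    (h : a + b = c) : α.comp (β - β') h = α.comp β h - α.comp β' h :=
  map_sub (Ext.bilinearComp X Y Z a b c h α) β β'

lemma mk₀_nsmul {X Y : C} (m : ℕ) (f : X ⟶ Y) : Ext.mk₀ (m • f) = m • Ext.mk₀.{w} f :=
  map_nsmul (Ext.addEquiv₀.symm : (X ⟶ Y) ≃+ Ext.{w} X Y 0) m f

lemma mk₀_nsmul_id_comp {X Y : C} {n : ℕ} (m : ℕ) (e : Ext.{w} X Y n) :
    (Ext.mk₀ (m • 𝟙 X)).comp e (zero_add n) = m • e := by
  rw [mk₀_nsmul, ext_nsmul_comp, Ext.mk₀_id_comp]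

lemma comp_mk₀_nsmul_id {X Y : C} {n : ℕ} (m : ℕ) (e : Ext.{w} X Y n) :
    e.comp (Ext.mk₀ (m • 𝟙 Y)) (add_zero n) = m • e := by
  rw [mk₀_nsmul, ext_comp_nsmul, Ext.comp_mk₀_id]

lemma ext_eq_zero_of_nsmul_eq_zero_of_isIso {X Y : C} {i m : ℕ} [IsIso (m • 𝟙 X)]
    {e : Ext.{w} X Y i} (he : m • e = 0) : e = 0 := by
  rw [← Ext.mk₀_id_comp e, ← IsIso.inv_hom_id (m • 𝟙 X), ← Ext.mk₀_comp_mk₀_assoc,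
    mk₀_nsmul_id_comp, he, Ext.comp_zero]

end ExtNSMul

section ExtVanishing

variable {C : Type u₁} [Category.{v₁} C] [Abelian C]

lemma shortExact_kernel {X Y : C} (f : X ⟶ Y) [Epi f] :
    (ShortComplex.mk _ _ (kernel.condition f)).ShortExact :=
  { exact := ShortComplex.exact_kernel f }

lemma shortExact_cokernel {X Y : C} (f : X ⟶ Y) [Mono f] :
    (ShortComplex.mk _ _ (cokernel.condition f)).ShortExact :=
  { exact := ShortComplex.exact_cokernel f }

variable [HasExt.{w} C]

instance isClosedUnderExtensions_subsingleton_ext_left (Y : C) (i : ℕ) :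
    ObjectProperty.IsClosedUnderExtensions fun X : C ↦ Subsingleton (Ext.{w} X Y i) where
  prop_X₂_of_shortExact {T} hT _ _ := subsingleton_of_forall_eq 0 fun e ↦ by
    obtain ⟨x, rfl⟩ := Ext.contravariant_sequence_exact₂ hT Y e (Subsingleton.elim _ _)
    rw [Subsingleton.elim x 0, Ext.comp_zero]

instance isClosedUnderExtensions_subsingleton_ext_right (X : C) (i : ℕ) :
    ObjectProperty.IsClosedUnderExtensions fun Y : C ↦ Subsingleton (Ext.{w} X Y i) where
  prop_X₂_of_shortExact {T} hT _ _ := subsingleton_of_forall_eq 0 fun e ↦ by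
    obtain ⟨x, rfl⟩ := Ext.covariant_sequence_exact₂ X hT e (Subsingleton.elim _ _)
    rw [Subsingleton.elim x 0, Ext.zero_comp]

lemma ext_eq_zero_of_nsmul_eq_zero_of_epi {X Y : C} {i m : ℕ} [Epi (m • 𝟙 Y)]
    [Subsingleton (Ext.{w} X (kernel (m • 𝟙 Y)) i)] {e : Ext.{w} X Y i} (he : m • e = 0) :
    e = 0 := by
  obtain ⟨x, rfl⟩ := Ext.covariant_sequence_exact₂ X (shortExact_kernel (m • 𝟙 Y)) e
    ((comp_mk₀_nsmul_id m e).trans he)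
  rw [Subsingleton.elim x 0, Ext.zero_comp]

lemma subsingleton_ext_of_nsmul_id_eq_zero {X Y : C} {i m : ℕ} [Epi (m • 𝟙 X)]
    (hY : m • 𝟙 Y = 0) [Subsingleton (Ext.{w} (kernel (m • 𝟙 X)) Y i)] :
    Subsingleton (Ext.{w} X Y i) := by
  refine subsingleton_of_forall_eq 0 fun e ↦ ?_
  obtain ⟨x, rfl⟩ := Ext.contravariant_sequence_exact₂ (shortExact_kernel (m • 𝟙 X)) Y e
    (Subsingleton.elim _ _)
  refine (mk₀_nsmul_id_comp m x).trans ?_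
  rw [← comp_mk₀_nsmul_id, hY, Ext.mk₀_zero, Ext.comp_zero]

lemma hd_le_coe_iff (n : ℕ) :
    hd C ≤ n ↔ ∀ i, n < i → ∀ X Y : C, Subsingleton (Ext.{w} X Y i) := by
  have hd_le_iff : hd C ≤ n ↔ ∀ X : C, HasProjectiveDimensionLE X n := by
    refine ⟨fun h X ↦ ?_, fun h ↦ iInf₂_le n fun X Y i hi ↦ (h X).subsingleton' i hi (Y := Y)⟩
    have h' : hd C < (n + 1 : ℕ) := h.trans_lt (by exact_mod_cast n.lt_succ_self)
    simp only [hd, iInf_lt_iff] at h'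
    obtain ⟨m, hm, hmn⟩ := h'
    exact ⟨fun i hi Y ↦ hm X Y i ((Nat.cast_lt.1 hmn).trans_le hi)⟩
  rw [hd_le_iff]
  exact ⟨fun h i hi X Y ↦ (h X).subsingleton _ _ i hi Y,
    fun h X ↦ .mk fun i hi Y e ↦ (h i hi X Y).elim _ _⟩

end ExtVanishing

section IsIsoModTorsion

/-- A homomorphism of abelian groups is an isomorphism up to `M`-torsion, for a multiplicative set
`M` of natural numbers, if every element of its kernel and of its cokernel is killed by an element
of `M`. -/
structure IsIsoModTorsion (M : Submonoid ℕ) {G H : Type*} [AddCommGroup G] [AddCommGroup H]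
    (φ : G →+ H) : Prop where
  exists_nsmul_eq_zero : ∀ x, φ x = 0 → ∃ m ∈ M, m • x = 0
  exists_map_eq_nsmul : ∀ y, ∃ m ∈ M, ∃ x, φ x = m • y

lemma isIsoModTorsion_bot_iff {G H : Type*} [AddCommGroup G] [AddCommGroup H] {φ : G →+ H} :
    IsIsoModTorsion ⊥ φ ↔ Function.Bijective φ := by
  refine ⟨fun h ↦ ⟨(injective_iff_map_eq_zero φ).2 fun x hx ↦ ?_, fun y ↦ ?_⟩,
    fun h ↦ ⟨fun x hx ↦ ⟨1, one_mem _, ?_⟩, fun y ↦ ⟨1, one_mem _, ?_⟩⟩⟩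
  · simpa [Submonoid.mem_bot] using h.exists_nsmul_eq_zero x hx
  · simpa [Submonoid.mem_bot] using h.exists_map_eq_nsmul y
  · simpa using (injective_iff_map_eq_zero φ).1 h.1 x hx
  · simpa using h.2 y

end IsIsoModTorsion

section ExactFunctor

variable {C : Type u₁} [Category.{v₁} C] {D : Type u₂} [Category.{v₂} D]

/-- A functor `F` dominates epimorphisms if every epimorphism onto an object `F.obj X` is refined
by the image under `F` of an epimorphism onto `X`. This is what is needed to lift the effaceability
of `Ext`-classes along `F`. -/
def DominatesEpis (F : C ⥤ D) : Prop :=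
  ∀ ⦃X : C⦄ ⦃W : D⦄ (p : W ⟶ F.obj X) [Epi p],
    ∃ (Z : C) (q : Z ⟶ X) (r : F.obj Z ⟶ W), Epi q ∧ r ≫ p = F.map q

variable [Abelian C] [HasExt.{w} C] [Abelian D] [HasExt.{w'} D]
  {F : C ⥤ D} [F.Additive] [PreservesFiniteLimits F] [PreservesFiniteColimits F]
  {M : Submonoid ℕ} {n : ℕ}

lemma isIsoModTorsion_mapExtAddHom_zero {X Y : C}
    (hF : IsIsoModTorsion M (F.mapAddHom : (X ⟶ Y) →+ _)) :
    IsIsoModTorsion M (F.mapExtAddHom X Y 0 : Ext.{w} X Y 0 →+ Ext.{w'} _ _ 0) where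
  exists_nsmul_eq_zero e he := by
    obtain ⟨f, rfl⟩ := (Ext.mk₀_bijective X Y).2 e
    rw [Functor.mapExtAddHom_apply, Ext.mapExactFunctor_mk₀, Ext.mk₀_eq_zero_iff] at he
    obtain ⟨m, hm, h⟩ := hF.exists_nsmul_eq_zero f he
    exact ⟨m, hm, by rw [← mk₀_nsmul, h, Ext.mk₀_zero]⟩
  exists_map_eq_nsmul e := by
    obtain ⟨g, rfl⟩ := (Ext.mk₀_bijective _ _).2 e
    obtain ⟨m, hm, f, hf⟩ := hF.exists_map_eq_nsmul g
    rw [Functor.mapAddHom_apply] at hf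
    exact ⟨m, hm, Ext.mk₀ f, by
      rw [Functor.mapExtAddHom_apply, Ext.mapExactFunctor_mk₀, hf, mk₀_nsmul]⟩

lemma exists_mk₀_map_f_comp_eq {T : ShortComplex C} (hT : T.ShortExact) {Y : D} {n' : ℕ}
    (f : Ext.{w'} (F.obj T.X₁) Y n) (hn : 1 + n = n')
    (hf : (hT.extClass.mapExactFunctor F).comp f hn = 0) :
    ∃ g : Ext.{w'} (F.obj T.X₂) Y n, (Ext.mk₀ (F.map T.f)).comp g (zero_add n) = f := by
  rw [Ext.mapExactFunctor_extClass] at hf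
  exact Ext.contravariant_sequence_exact₁ (hT.map_of_exact F) Y f hn hf

lemma exists_mapExactFunctor_extClass_comp_eq {T : ShortComplex C} (hT : T.ShortExact) {Y : D}
    {n' : ℕ} (e : Ext.{w'} (F.obj T.X₃) Y n') (hn : 1 + n = n')
    (he : (Ext.mk₀ (F.map T.g)).comp e (zero_add n') = 0) :
    ∃ f : Ext.{w'} (F.obj T.X₁) Y n, (hT.extClass.mapExactFunctor F).comp f hn = e := by
  rw [Ext.mapExactFunctor_extClass]
  exact Ext.contravariant_sequence_exact₃ (hT.map_of_exact F) Y e he hn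

lemma exists_nsmul_eq_zero_of_mapExactFunctor_eq_zero
    (hF : ∀ X Y : C,
      IsIsoModTorsion M (F.mapExtAddHom X Y n : Ext.{w} X Y n →+ Ext.{w'} _ _ n))
    {X Y : C} {e : Ext.{w} X Y (n + 1)}
    (he : e.mapExactFunctor F = (0 : Ext.{w'} _ _ (n + 1))) :
    ∃ m ∈ M, m • e = 0 := by
  obtain ⟨Z, p, _, hp⟩ := exists_epi_mk₀_comp_eq_zero e
  let T := ShortComplex.mk _ _ (kernel.condition p)
  have hT : T.ShortExact := shortExact_kernel p
  obtain ⟨f, rfl⟩ := Ext.contravariant_sequence_exact₃ hT Y e hp (add_comm 1 n)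
  rw [Ext.mapExactFunctor_comp] at he
  obtain ⟨g, hg⟩ := exists_mk₀_map_f_comp_eq hT _ _ he
  obtain ⟨m, hm, g', hg'⟩ := (hF _ _).exists_map_eq_nsmul g
  have hfg : F.mapExtAddHom T.X₁ Y n (m • f - (Ext.mk₀ T.f).comp g' (zero_add n)) =
      (0 : Ext.{w'} _ _ n) := by
    rw [map_sub, map_nsmul, Functor.mapExtAddHom_apply, Functor.mapExtAddHom_apply, ← hg,
      Ext.mapExactFunctor_comp, Ext.mapExactFunctor_mk₀, ← Functor.mapExtAddHom_apply, hg',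
      ext_comp_nsmul, sub_self]
  obtain ⟨m', hm', h⟩ := (hF _ _).exists_nsmul_eq_zero _ hfg
  have hδ := congr_arg (fun x ↦ hT.extClass.comp x (add_comm 1 n)) h
  rw [ext_comp_nsmul, ext_comp_sub, ext_comp_nsmul, hT.extClass_comp_assoc, sub_zero,
    Ext.comp_zero, smul_smul] at hδ
  exact ⟨m' * m, M.mul_mem hm' hm, hδ⟩

lemma exists_mapExactFunctor_eq_nsmul (hdom : DominatesEpis F)
    (hF : ∀ X Y : C,
      IsIsoModTorsion M (F.mapExtAddHom X Y n : Ext.{w} X Y n →+ Ext.{w'} _ _ n))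
    {X Y : C} (e : Ext.{w'} (F.obj X) (F.obj Y) (n + 1)) :
    ∃ m ∈ M, ∃ e' : Ext.{w} X Y (n + 1), e'.mapExactFunctor F = m • e := by
  obtain ⟨W, p, _, hpe⟩ := exists_epi_mk₀_comp_eq_zero e
  obtain ⟨Z, q, r, _, hq⟩ := hdom p
  let T := ShortComplex.mk _ _ (kernel.condition q)
  have hT : T.ShortExact := shortExact_kernel q
  have hqe : (Ext.mk₀ (F.map q)).comp e (zero_add _) = 0 := by
    rw [← hq, ← Ext.mk₀_comp_mk₀_assoc, hpe, Ext.comp_zero]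
  obtain ⟨f, rfl⟩ := exists_mapExactFunctor_extClass_comp_eq hT e (add_comm 1 n) hqe
  obtain ⟨m, hm, g, hg⟩ := (hF T.X₁ Y).exists_map_eq_nsmul f
  refine ⟨m, hm, hT.extClass.comp g (add_comm 1 n), ?_⟩
  rw [Ext.mapExactFunctor_comp, ← Functor.mapExtAddHom_apply _ _ _ _ g, hg, ext_comp_nsmul]

theorem isIsoModTorsion_mapExtAddHom (hdom : DominatesEpis F)
    (hF : ∀ X Y : C, IsIsoModTorsion M (F.mapAddHom : (X ⟶ Y) →+ _)) (n : ℕ) (X Y : C) :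
    IsIsoModTorsion M (F.mapExtAddHom X Y n : Ext.{w} X Y n →+ Ext.{w'} _ _ n) := by
  induction n generalizing X Y with
  | zero => exact isIsoModTorsion_mapExtAddHom_zero (hF X Y)
  | succ n ih =>
    exact ⟨fun _ he ↦ exists_nsmul_eq_zero_of_mapExactFunctor_eq_zero ih he,
      exists_mapExactFunctor_eq_nsmul hdom ih⟩

theorem bijective_mapExtAddHom [F.Full] [F.Faithful] (hdom : DominatesEpis F) (n : ℕ) (X Y : C) :
    Function.Bijective (F.mapExtAddHom X Y n : Ext.{w} X Y n →+ Ext.{w'} _ _ n) :=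
  isIsoModTorsion_bot_iff.1 <| isIsoModTorsion_mapExtAddHom hdom
    (fun _ _ ↦ isIsoModTorsion_bot_iff.2 ⟨F.map_injective, F.map_surjective⟩) n X Y

end ExactFunctor

section SerreClass

variable {C : Type u₁} [Category.{v₁} C] [Abelian C] (P : ObjectProperty C)

instance [P.ContainsZero] [P.IsClosedUnderKernels] [P.IsClosedUnderCokernels]
    [P.IsClosedUnderFiniteProducts] : PreservesFiniteLimits P.ι := by
  rw [((Functor.preservesFiniteLimits_tfae P.ι).out 3 2 :)]
  exact fun _ _ f ↦ P.preservesKernels_ι f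

instance [P.ContainsZero] [P.IsClosedUnderKernels] [P.IsClosedUnderCokernels]
    [P.IsClosedUnderFiniteProducts] : PreservesFiniteColimits P.ι := by
  rw [((Functor.preservesFiniteColimits_tfae P.ι).out 3 2 :)]
  exact fun _ _ f ↦ P.preservesCokernels_ι f

lemma exists_mono_epiModSerre_minimal [P.IsSerreClass] (X : C) [IsArtinianObject X] :
    ∃ (D : C) (i : D ⟶ X), Mono i ∧ P.epiModSerre i ∧
      ∀ ⦃Z : C⦄ (j : Z ⟶ D) [Mono j], P.epiModSerre j → IsIso j := by
  obtain ⟨B, hB, hmin⟩ := (wellFounded_lt (α := Subobject X)).has_min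
    {B | P.epiModSerre B.arrow} ⟨⊤, P.epiModSerre_of_epi _⟩
  refine ⟨B, B.arrow, inferInstance, hB, fun Z j _ hj ↦ ?_⟩
  have hjB : Subobject.mk (j ≫ B.arrow) = B := by
    refine (Subobject.mk_le_of_comm j rfl).eq_of_not_lt (hmin _ ?_)
    rw [Set.mem_ofPred_eq, ← Subobject.underlyingIso_hom_comp_eq_mk]
    exact P.epiModSerre.comp_mem _ _ (P.epiModSerre_of_epi _) (P.epiModSerre.comp_mem _ _ hj hB)
  rw [Subobject.isIso_iff_mk_eq_top]
  apply Subobject.map_obj_injective B.arrow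
  rw [Subobject.map_mk, Subobject.map_top, Subobject.mk_arrow, hjB]

end SerreClass

section Abelian

variable {C : Type u₁} [Category.{v₁} C] [Abelian C]

lemma epi_kernel_ι_comp {X Y Z W : C} {i : X ⟶ W} {e : W ⟶ Y} {p : W ⟶ Z} [Epi p] [Epi (i ≫ e)]
    (hip : i ≫ p = 0) : Epi (kernel.ι e ≫ p) := by
  have : Epi e := epi_of_epi i e
  refine Preadditive.epi_of_cancel_zero _ fun {G} g hg ↦ ?_
  have hpg : kernel.ι e ≫ p ≫ g = 0 := by rwa [← Category.assoc]
  have hdesc : epiDesc e (p ≫ g) hpg = 0 := by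
    rw [← cancel_epi (i ≫ e), Category.assoc, comp_epiDesc, reassoc_of% hip, zero_comp, comp_zero]
  rw [← cancel_epi p, ← comp_epiDesc e (p ≫ g) hpg, hdesc, comp_zero, comp_zero]

end Abelian

section Torsion

variable {A : Type u} [Category.{v} A] [Abelian A] {S : Set Nat.Primes}

lemma torsion_of_mono_of_nsmul_eq_zero {X Y : A} (f : X ⟶ Y) [Mono f] {n : ℕ}
    (hn : n ∈ primeSpan S) (h : n • f = 0) : torsion A S X :=
  ⟨n, hn, by rw [← cancel_mono f, Preadditive.nsmul_comp, Category.id_comp, h, zero_comp]⟩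

lemma torsion_of_epi_of_nsmul_eq_zero {X Y : A} (f : X ⟶ Y) [Epi f] {n : ℕ}
    (hn : n ∈ primeSpan S) (h : n • f = 0) : torsion A S Y :=
  ⟨n, hn, by rw [← cancel_epi f, Preadditive.comp_nsmul, Category.comp_id, h, comp_zero]⟩

lemma nsmul_eq_zero_of_src {X Y : A} {n : ℕ} (h : n • 𝟙 X = 0) (f : X ⟶ Y) : n • f = 0 := by
  rw [← Category.id_comp f, ← Preadditive.nsmul_comp, h, zero_comp]

lemma nsmul_eq_zero_of_tgt {X Y : A} {n : ℕ} (h : n • 𝟙 Y = 0) (f : X ⟶ Y) : n • f = 0 := by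
  rw [← Category.comp_id f, ← Preadditive.comp_nsmul, h, comp_zero]

lemma isoModSerre_nsmul_id (X : A) {n : ℕ} (hn : n ∈ primeSpan S) :
    (torsion A S).isoModSerre (n • 𝟙 X) := by
  refine ⟨torsion_of_mono_of_nsmul_eq_zero (kernel.ι (n • 𝟙 X)) hn ?_,
    torsion_of_epi_of_nsmul_eq_zero (cokernel.π (n • 𝟙 X)) hn ?_⟩
  · simpa using kernel.condition (n • 𝟙 X)
  · simpa only [Preadditive.nsmul_comp, Category.id_comp] using cokernel.condition (n • 𝟙 X)

lemma exists_comp_eq_nsmul_id_of_mono {X Y : A} (f : X ⟶ Y) [Mono f]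
    (hf : (torsion A S).epiModSerre f) : ∃ n ∈ primeSpan S, ∃ g : Y ⟶ X, g ≫ f = n • 𝟙 Y := by
  obtain ⟨n, hn, h⟩ := hf
  have hπ : (n • 𝟙 Y) ≫ cokernel.π f = 0 := by
    rw [Preadditive.nsmul_comp, Category.id_comp, nsmul_eq_zero_of_tgt h]
  exact ⟨n, hn, monoLift f (n • 𝟙 Y) hπ, monoLift_comp f _ hπ⟩

lemma exists_comp_eq_nsmul_id_of_epi {X Y : A} (f : X ⟶ Y) [Epi f]
    (hf : (torsion A S).monoModSerre f) : ∃ n ∈ primeSpan S, ∃ g : Y ⟶ X, g ≫ f = n • 𝟙 Y := by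
  obtain ⟨n, hn, h⟩ := hf
  have hι : kernel.ι f ≫ (n • 𝟙 X) = 0 := by
    rw [Preadditive.comp_nsmul, Category.comp_id, nsmul_eq_zero_of_src h]
  refine ⟨n, hn, epiDesc f (n • 𝟙 X) hι, ?_⟩
  rw [← cancel_epi f, ← Category.assoc, comp_epiDesc]
  simp

lemma exists_comp_eq_nsmul_id {X Y : A} {f : X ⟶ Y} (hf : (torsion A S).isoModSerre f) :
    ∃ n ∈ primeSpan S, ∃ g : Y ⟶ X, g ≫ f = n • 𝟙 Y := by
  obtain ⟨a, ha, s, hs⟩ := exists_comp_eq_nsmul_id_of_mono _ hf.2.isoModSerre_image_ι.2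
  obtain ⟨b, hb, t, ht⟩ := exists_comp_eq_nsmul_id_of_epi _ hf.1.isoModSerre_factorThruImage.1
  have htf : t ≫ f = b • Abelian.image.ι f := by simpa using ht =≫ Abelian.image.ι f
  refine ⟨b * a, mul_mem_primeSpan hb ha, s ≫ t, ?_⟩
  rw [Category.assoc, htf, Preadditive.comp_nsmul, hs, mul_smul]

lemma exists_epi_nsmul_eq_comp {W X : A} {f : W ⟶ X} (hf : (torsion A S).epiModSerre f) :
    ∃ n ∈ primeSpan S, ∃ (Z : A) (q : Z ⟶ X) (a : Z ⟶ W), Epi q ∧ n • q = a ≫ f := by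
  obtain ⟨n, hn, g, hg⟩ := exists_comp_eq_nsmul_id_of_mono _ hf.isoModSerre_image_ι.2
  refine ⟨n, hn, _, pullback.snd (Abelian.factorThruImage f) g, pullback.fst _ _,
    inferInstance, ?_⟩
  simpa [hg] using (pullback.condition (f := Abelian.factorThruImage f) (g := g) =≫
    Abelian.image.ι f).symm

end Torsion

section Divisible

variable (A : Type u) [Category.{v} A] [Abelian A] (S : Set Nat.Primes)

/-- The `S`-divisible objects: those on which multiplication by every `m ∈ ⟨S⟩` is an epimorphism.
They complement the `S`-torsion objects in the dévissage of an artinian object. -/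
def divisible : ObjectProperty A := fun D ↦ ∀ m ∈ primeSpan S, Epi (m • 𝟙 D)

/-- The objects which are extensions of an `S`-torsion object by an `S`-divisible one. -/
def divisibleByTorsion : ObjectProperty A := fun X ↦
  ∃ (D : A) (i : D ⟶ X), Mono i ∧ divisible A S D ∧ torsion A S (cokernel i)

variable {A S}

lemma divisibleByTorsion_of_isArtinianObject (X : A) [IsArtinianObject X] :
    divisibleByTorsion A S X := by
  obtain ⟨D, i, hi, hiS, hmin⟩ := exists_mono_epiModSerre_minimal (torsion A S) X
  refine ⟨D, i, hi, fun m hm ↦ ?_, hiS⟩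
  have := hmin _ (isoModSerre_nsmul_id D hm).2.isoModSerre_image_ι.2
  rw [← Abelian.image.fac (m • 𝟙 D)]
  infer_instance

lemma divisibleByTorsion_le {P : ObjectProperty A} [P.IsClosedUnderExtensions]
    (hdiv : divisible A S ≤ P) (htors : torsion A S ≤ P) : divisibleByTorsion A S ≤ P := by
  rintro X ⟨D, i, _, hD, hi⟩
  exact P.prop_X₂_of_shortExact (shortExact_cokernel i) (hdiv _ hD) (htors _ hi)

lemma eq_zero_of_divisible_of_torsion {D T : A} (hD : divisible A S D) (hT : torsion A S T)
    (f : D ⟶ T) : f = 0 := by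
  obtain ⟨n, hn, hT⟩ := hT
  have := hD n hn
  rw [← cancel_epi (n • 𝟙 D), Preadditive.nsmul_comp, Category.id_comp,
    nsmul_eq_zero_of_tgt hT, comp_zero]

lemma exists_torsion_epi_comp {W T : A} (hW : divisibleByTorsion A S W) (hT : torsion A S T)
    (p : W ⟶ T) [Epi p] : ∃ (Z : A) (r : Z ⟶ W), torsion A S Z ∧ Epi (r ≫ p) := by
  obtain ⟨D, i, _, hD, hi⟩ := hW
  obtain ⟨n, hn, e, he⟩ := exists_comp_eq_nsmul_id_of_mono i hi
  have hie : i ≫ e = n • 𝟙 D := by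
    rw [← cancel_mono i, Category.assoc, he]
    simp
  have : Epi (i ≫ e) := hie ▸ hD n hn
  refine ⟨kernel e, kernel.ι e, torsion_of_mono_of_nsmul_eq_zero (kernel.ι e) hn ?_,
    epi_kernel_ι_comp (i := i) (eq_zero_of_divisible_of_torsion hD hT _)⟩
  rw [← Category.comp_id (kernel.ι e), ← Preadditive.comp_nsmul, ← he, kernel.condition_assoc,
    zero_comp]

lemma dominatesEpis_torsion_ι (H : ∀ X : A, divisibleByTorsion A S X) :
    DominatesEpis (torsion A S).ι := by
  intro X W p _
  obtain ⟨Z, r, hZ, hr⟩ := exists_torsion_epi_comp (H W) X.property p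
  let q : (⟨Z, hZ⟩ : TorsionSubcategory A S) ⟶ X := (torsion A S).homMk (r ≫ p)
  exact ⟨⟨Z, hZ⟩, q, r, (torsion A S).ι.epi_of_epi_map hr, rfl⟩

end Divisible

section Quotient

/-- The set `⟨S⟩` as a submonoid of `ℕ`. -/
def primeSpanSubmonoid (S : Set Nat.Primes) : Submonoid ℕ where
  carrier := primeSpan S
  one_mem' := one_mem_primeSpan S
  mul_mem' := mul_mem_primeSpan

variable (A : Type u) [Category.{v} A] [Abelian A] (S : Set Nat.Primes)

/-- The quotient functor `A ⥤ A / A_S`. -/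
abbrev quotientFunctor : A ⥤ TorsionQuotient A S := (torsion A S).isoModSerre.Q

instance : PreservesFiniteLimits (quotientFunctor A S) :=
  ObjectProperty.SerreClassLocalization.preservesFiniteLimits _ (torsion A S)

instance : PreservesFiniteColimits (quotientFunctor A S) :=
  ObjectProperty.SerreClassLocalization.preservesFiniteColimits _ (torsion A S)

lemma quotientFunctor_obj_surjective : Function.Surjective (quotientFunctor A S).obj :=
  (Localization.Construction.objEquiv _).surjective

variable {A S}

lemma isIso_nsmul_id (X : TorsionQuotient A S) {n : ℕ} (hn : n ∈ primeSpan S) :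
    IsIso (n • 𝟙 X) := by
  obtain ⟨X, rfl⟩ := quotientFunctor_obj_surjective A S X
  rw [← CategoryTheory.Functor.map_id, ← Functor.map_nsmul]
  exact Localization.inverts _ _ _ (isoModSerre_nsmul_id X hn)

lemma isIsoModTorsion_mapAddHom_quotientFunctor (X Y : A) :
    IsIsoModTorsion (primeSpanSubmonoid S) ((quotientFunctor A S).mapAddHom : (X ⟶ Y) →+ _) where
  exists_nsmul_eq_zero f hf := by
    obtain ⟨n, hn, h⟩ :=
      (ObjectProperty.SerreClassLocalization.map_eq_zero_iff _ (torsion A S) f).1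
        (by rwa [Functor.mapAddHom_apply] at hf)
    refine ⟨n, hn, ?_⟩
    rw [← Abelian.image.fac f, ← Preadditive.nsmul_comp, nsmul_eq_zero_of_tgt h, zero_comp]
  exists_map_eq_nsmul g := by
    obtain ⟨φ, rfl⟩ := Localization.exists_rightFraction (quotientFunctor A S)
      (torsion A S).isoModSerre g
    obtain ⟨n, hn, t, ht⟩ := exists_comp_eq_nsmul_id φ.hs
    refine ⟨n, hn, t ≫ φ.f, ?_⟩
    rw [Functor.mapAddHom_apply, Functor.map_comp,
      ← φ.map_s_comp_map _ (Localization.inverts _ _), ← Functor.map_comp_assoc, ht,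
      Functor.map_nsmul, CategoryTheory.Functor.map_id, Preadditive.nsmul_comp, Category.id_comp]

lemma dominatesEpis_quotientFunctor : DominatesEpis (quotientFunctor A S) := by
  intro X W p _
  obtain ⟨W, rfl⟩ := quotientFunctor_obj_surjective A S W
  obtain ⟨m, hm, f, hf⟩ :=
    (isIsoModTorsion_mapAddHom_quotientFunctor W X).exists_map_eq_nsmul p
  rw [Functor.mapAddHom_apply] at hf
  have : Epi ((quotientFunctor A S).map f) := by
    have := isIso_nsmul_id ((quotientFunctor A S).obj X) hm
    rw [hf, ← Category.comp_id p, ← Preadditive.comp_nsmul]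
    infer_instance
  rw [ObjectProperty.SerreClassLocalization.epi_map_iff _ (torsion A S)] at this
  obtain ⟨n, hn, Z, q, a, hq, hqa⟩ := exists_epi_nsmul_eq_comp this
  have := isIso_nsmul_id ((quotientFunctor A S).obj Z) hn
  refine ⟨Z, q, inv (n • 𝟙 _) ≫ (m • (quotientFunctor A S).map a), hq, ?_⟩
  rw [Category.assoc, IsIso.inv_comp_eq, Preadditive.nsmul_comp, ← Preadditive.comp_nsmul, ← hf,
    ← Functor.map_comp, ← hqa, Functor.map_nsmul, Preadditive.nsmul_comp, Category.id_comp]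

end Quotient

section HomologicalDimension

variable {A : Type u} [Category.{v} A] [Abelian A] {S : Set Nat.Primes} [HasExt.{w} A] {i : ℕ}

lemma subsingleton_ext_of_forall_exists_nsmul_eq_zero (H : ∀ X : A, divisibleByTorsion A S X)
    (htors : ∀ T T' : A, torsion A S T → torsion A S T' → Subsingleton (Ext.{w} T T' i))
    (hnsmul : ∀ {X Y : A} (e : Ext.{w} X Y i), ∃ m ∈ primeSpan S, m • e = 0) (X Y : A) :
    Subsingleton (Ext.{w} X Y i) := by
  have to_torsion {X T : A} (hT : torsion A S T) : Subsingleton (Ext.{w} X T i) := by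
    refine divisibleByTorsion_le (P := fun X ↦ Subsingleton (Ext.{w} X T i))
      (fun D hD ↦ ?_) (fun T' hT' ↦ htors T' T hT' hT) X (H X)
    obtain ⟨m, hm, hmT⟩ := hT
    have := hD m hm
    have := htors (kernel (m • 𝟙 D)) T (isoModSerre_nsmul_id D hm).1 ⟨m, hm, hmT⟩
    exact subsingleton_ext_of_nsmul_id_eq_zero hmT
  have to_divisible {X D : A} (hD : divisible A S D) : Subsingleton (Ext.{w} X D i) := by
    refine subsingleton_of_forall_eq 0 fun e ↦ ?_
    obtain ⟨m, hm, he⟩ := hnsmul e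
    have := hD m hm
    have : Subsingleton (Ext.{w} X (kernel (m • 𝟙 D)) i) :=
      to_torsion (isoModSerre_nsmul_id D hm).1
    exact ext_eq_zero_of_nsmul_eq_zero_of_epi he
  exact divisibleByTorsion_le (P := fun Y ↦ Subsingleton (Ext.{w} X Y i))
    (fun _ ↦ to_divisible) (fun _ ↦ to_torsion) Y (H Y)

variable [HasExt.{w'} (TorsionSubcategory A S)] [HasExt.{w''} (TorsionQuotient A S)]

theorem forall_subsingleton_ext_iff (H : ∀ X : A, divisibleByTorsion A S X) (i : ℕ) :
    (∀ X Y : A, Subsingleton (Ext.{w} X Y i)) ↔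
      (∀ X Y : TorsionSubcategory A S, Subsingleton (Ext.{w'} X Y i)) ∧
        ∀ X Y : TorsionQuotient A S, Subsingleton (Ext.{w''} X Y i) := by
  have hι (X Y : TorsionSubcategory A S) :=
    bijective_mapExtAddHom.{w', w} (dominatesEpis_torsion_ι H) i X Y
  have hQ := isIsoModTorsion_mapExtAddHom.{w, w''} dominatesEpis_quotientFunctor
    (isIsoModTorsion_mapAddHom_quotientFunctor (A := A) (S := S)) i
  refine ⟨fun h ↦ ⟨fun X Y ↦ ?_, fun X Y ↦ subsingleton_of_forall_eq 0 fun e ↦ ?_⟩, fun h ↦ ?_⟩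
  · have := h X.obj Y.obj
    exact (hι X Y).1.subsingleton
  · obtain ⟨X, rfl⟩ := quotientFunctor_obj_surjective A S X
    obtain ⟨Y, rfl⟩ := quotientFunctor_obj_surjective A S Y
    obtain ⟨m, hm, e', he⟩ := (hQ X Y).exists_map_eq_nsmul e
    have := isIso_nsmul_id ((quotientFunctor A S).obj X) hm
    refine ext_eq_zero_of_nsmul_eq_zero_of_isIso (m := m) ?_
    rw [← he, (h X Y).elim e' 0, map_zero]
  · refine subsingleton_ext_of_forall_exists_nsmul_eq_zero H (fun T T' hT hT' ↦ ?_) fun {X Y} e ↦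
      (hQ X Y).exists_nsmul_eq_zero e ((h.2 _ _).elim _ _)
    have := h.1 ⟨T, hT⟩ ⟨T', hT'⟩
    exact (hι ⟨T, hT⟩ ⟨T', hT'⟩).2.subsingleton

end HomologicalDimension

end TorsionHd

theorem theorem2_general {A : Type u} [CategoryTheory.Category.{v} A] [CategoryTheory.Abelian A]
    (S : Set Nat.Primes) (H : ∀ X : A, TorsionHd.divisibleByTorsion A S X) :
    TorsionHd.hd A =
      max (TorsionHd.hd (TorsionHd.TorsionSubcategory A S))
        (TorsionHd.hd (TorsionHd.TorsionQuotient A S)) := by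
  open CategoryTheory TorsionHd in
  have := HasExt.standard A
  have := HasExt.standard (TorsionSubcategory A S)
  have := HasExt.standard (TorsionQuotient A S)
  refine WithTop.eq_of_forall_le_coe_iff fun n ↦ ?_
  change hd A ≤ (n : ℕ∞) ↔ max _ _ ≤ (n : ℕ∞)
  rw [max_le_iff, hd_le_coe_iff, hd_le_coe_iff, hd_le_coe_iff, ← forall₂_and]
  exact forall₂_congr fun i _ ↦ forall_subsingleton_ext_iff H i

theorem theorem2 {A : Type u} [CategoryTheory.Category.{v} A] [CategoryTheory.Abelian A]
    (hA : ∀ X : A, CategoryTheory.IsArtinianObject X) (S : Set Nat.Primes) :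
    TorsionHd.hd A =
      max (TorsionHd.hd (TorsionHd.TorsionSubcategory A S))
        (TorsionHd.hd (TorsionHd.TorsionQuotient A S)) :=
  theorem2_general S fun X ↦ have := hA X; TorsionHd.divisibleByTorsion_of_isArtinianObject X
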